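/- Let $\mathbb I=[0,1]$, let $\lambda$ be Lebesgue measure, and let $\mathcal C^d$ be the set of $d$-dimensional copulas; for $C\in\mathcal C^3$ let $\mu_C$ be the associated probability measure on $\mathbb I^3$ (with uniform univariate margins), so that $C(\mathbf u,v)=\mu_C([\mathbf 0,\mathbf u]\times[0,v])$ for $(\mathbf u,v)\in\mathbb I^2\times\mathbb I$. Let $K_C(v,\cdot)$ denote (a version of) the regular conditional distribution under $\mu_C$ of the first two coordinates given that the third coordinate equals $v$, and put $F_{1|3}(x|t)=K_C(t,[0,x]\times\mathbb I)$ and $F_{2|3}(x|t)=K_C(t,\mathbb I\times[0,x])$. The copula $C$ is called simplified if $F_{1|3}(\cdot|t)$ and $F_{2|3}(\cdot|t)$ are continuous for $\lambda$-almost every $t$ and there is a bivariate copula $A\in\mathcal C^2$ such that $$C(\mathbf u,v)=\int_{[0,v]}A\big(F_{1|3}(u_1|t),F_{2|3}(u_2|t)\big)\,\mathrm d\lambda(t)\qquad\text{for all }(\mathbf u,v)\in\mathbb I^2\times\mathbb I .$$ On $\mathcal C^3$ consider the metrics $$D_1(C_1,C_2)=\int_{\mathbb I^2}\int_{\mathbb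 I}\big|K_{C_1}(v,[\mathbf 0,\mathbf u])-K_{C_2}(v,[\mathbf 0,\mathbf u])\big|\,\mathrm d\lambda(v)\,\mathrm d\lambda^2(\mathbf u),$$ $$D_\infty(C_1,C_2)=\sup_{\mathbf u\in\mathbb I^2}\int_{\mathbb I}\big|K_{C_1}(v,[\mathbf 0,\mathbf u])-K_{C_2}(v,[\mathbf 0,\mathbf u])\big|\,\mathrm d\lambda(v).$$ A sequence $(C_n)$ in $\mathcal C^3$ converges weakly conditionally to $C$ if for $\lambda$-almost every $v$ the measures $K_{C_n}(v,\cdot)$ converge weakly to $K_C(v,\cdot)$. The topology induced by weak conditional convergence is the finest topology on $\mathcal C^3$ in which every weakly conditionally convergent sequence converges to its weak conditional limit; that is, $U$ is open if and only if every sequence converging weakly conditionally to a point of $U$ is eventually in $U$. Finally, let $\mathcal C^3_{\mathrm{ac},>0}$ be the set of all absolutely continuous $C\in\mathcal C^3$ whose density is positive $\lambda^3$-almost everywhere. **Theorem.** 1. The set of all simplified copulas is nowhere dense in $(\mathcal C^3,D_1)$ and in $(\mathcal C^3,D_\infty)$. 2. The set of all simplified copulas is nowhere dense in $\mathcal C^3$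 with respect to the topology induced by weak conditional convergence. 3. The set of all simplified copulas belonging to $\mathcal C^3_{\mathrm{ac},>0}$ is nowhere dense in $(\mathcal C^3_{\mathrm{ac},>0},D_1)$ and in $(\mathcal C^3_{\mathrm{ac},>0},D_\infty)$. -/

import Mathlib

open MeasureTheory ProbabilityTheory Filter Set
open scoped unitInterval Topology ENNReal

noncomputable section

/-- A bivariate copula, given by its doubly stochastic measure on `I²`: a Borel measure whose
two univariate margins are uniform. -/
structure Copula2 where
  measure : Measure (I × I)
  map_fst : measure.map Prod.fst = volume
  map_snd : measure.map Prod.snd = volume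

/-- The copula as a function on `I²`: `A(a, b) = μ_A([0,a] × [0,b])`. -/
def Copula2.cdf (A : Copula2) (a b : I) : ℝ := A.measure.real (Iic (a, b))

/-- A trivariate copula, given by its `3`-stochastic measure on `I² × I`: a Borel measure whose
three univariate margins are uniform. Points of the cube are written `(𝐮, v)` with `𝐮 ∈ I²`. -/
@[ext]
structure Copula3 where
  measure : Measure ((I × I) × I)
  map_one : measure.map (fun p => p.1.1) = volume
  map_two : measure.map (fun p => p.1.2) = volume
  map_three : measure.map (fun p => p.2) = volume

namespace Copula3

instance (C : Copula3) : IsProbabilityMeasure C.measure := by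
  constructor
  have h := congrArg (fun m => m univ) C.map_three
  simpa [Measure.map_apply measurable_snd MeasurableSet.univ] using h

instance (C : Copula3) : IsProbabilityMeasure (C.measure.map Prod.swap) :=
  Measure.isProbabilityMeasure_map measurable_swap.aemeasurable

/-- The copula as a function on `I³`: `C(𝐮, v) = μ_C([𝟎,𝐮] × [0,v])`. -/
def cdf (C : Copula3) (u : I × I) (v : I) : ℝ := C.measure.real (Iic (u, v))

/-- A copula is determined by its distribution function, so that passing between copulas and
their `3`-stochastic measures loses nothing. -/
theorem ext_of_cdf {C D : Copula3} (h : ∀ u v, C.cdf u v = D.cdf u v) : C = D := by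
  apply Copula3.ext
  have hI : (inferInstance : MeasurableSpace I) =
      MeasurableSpace.generateFrom (range (Iic : I → Set I)) := by
    rw [← borel_eq_generateFrom_Iic]; exact BorelSpace.measurable_eq
  have hsp : IsCountablySpanning (range (Iic : I → Set I)) :=
    ⟨fun _ => Iic 1, fun _ => ⟨1, rfl⟩, by ext x; simp [unitInterval.le_one']⟩
  have h2 := (generateFrom_eq_prod hI.symm hI.symm hsp hsp)
  have h3 := (generateFrom_eq_prod h2 hI.symm (hsp.prod hsp) hsp)
  refine ext_of_generate_finite _ h3.symm
    ((isPiSystem_Iic.prod isPiSystem_Iic).prod isPiSystem_Iic) ?_ (by simp)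
  rintro _ ⟨_, ⟨_, ⟨a, rfl⟩, _, ⟨b, rfl⟩, rfl⟩, _, ⟨c, rfl⟩, rfl⟩
  have := h (a, b) c
  simp only [Copula3.cdf, Measure.real] at this
  rw [ENNReal.toReal_eq_toReal_iff' (measure_ne_top _ _) (measure_ne_top _ _)] at this
  simpa [Iic_prod_Iic] using this

/-- The Markov kernel `K_C` of `C`: (a version of) the regular conditional distribution of the
first two coordinates given the third one. -/
def kernel (C : Copula3) : Kernel I (I × I) := (C.measure.map Prod.swap).condKernel

instance (C : Copula3) : IsMarkovKernel C.kernel :=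
  inferInstanceAs (IsMarkovKernel (C.measure.map Prod.swap).condKernel)

/-- `K_C(t, ·)` as a probability measure on `I²`. -/
def condLaw (C : Copula3) (t : I) : ProbabilityMeasure (I × I) := ⟨C.kernel t, inferInstance⟩

/-- The conditional univariate distribution function `F_{1|3}(x | t)`. -/
def F₁ (C : Copula3) (x t : I) : I :=
  ⟨(C.kernel t).real {u | u.1 ≤ x}, measureReal_nonneg, measureReal_le_one⟩

/-- The conditional univariate distribution function `F_{2|3}(x | t)`. -/
def F₂ (C : Copula3) (x t : I) : I :=
  ⟨(C.kernel t).real {u | u.2 ≤ x}, measureReal_nonneg, measureReal_le_one⟩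

/-- `C` is generalized simplified (with respect to the third coordinate): one bivariate copula
`A` serves as conditional copula for all values of the conditioning variable. -/
def IsGeneralizedSimplified (C : Copula3) : Prop :=
  ∃ A : Copula2, ∀ (u : I × I) (v : I),
    C.cdf u v = ∫ t in Iic v, A.cdf (C.F₁ u.1 t) (C.F₂ u.2 t)

/-- Almost all conditional univariate distribution functions are continuous. -/
def HasContinuousCondMargins (C : Copula3) : Prop :=
  ∀ᵐ t : I, Continuous (fun x => C.F₁ x t) ∧ Continuous (fun x => C.F₂ x t)

/-- Simplified copulas. -/
def IsSimplified (C : Copula3) : Prop :=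
  C.IsGeneralizedSimplified ∧ C.HasContinuousCondMargins

/-- `C` is absolutely continuous with a density that is positive Lebesgue almost everywhere. -/
def HasPositiveDensity (C : Copula3) : Prop :=
  ∃ c : (I × I) × I → ℝ≥0∞, Measurable c ∧ (∀ᵐ p, 0 < c p) ∧ C.measure = volume.withDensity c

/-- The metric `D₁`. -/
def D₁ (C₁ C₂ : Copula3) : ℝ :=
  ∫ u : I × I, ∫ v : I, |(C₁.kernel v).real (Iic u) - (C₂.kernel v).real (Iic u)|

/-- The metric `D_∞`. -/
def Dinf (C₁ C₂ : Copula3) : ℝ :=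
  ⨆ u : I × I, ∫ v : I, |(C₁.kernel v).real (Iic u) - (C₂.kernel v).real (Iic u)|

/-- Weak conditional convergence: for almost every `v`, the conditional laws `K_{Cₙ}(v, ·)`
converge weakly to `K_C(v, ·)`. -/
def WCC (Cs : ℕ → Copula3) (C : Copula3) : Prop :=
  ∀ᵐ v : I, Tendsto (fun n => (Cs n).condLaw v) atTop (𝓝 (C.condLaw v))

/-- The topology induced by weak conditional convergence: the finest topology for which every
weakly conditionally convergent sequence converges to its limit. A set `U` is open iff every
sequence that converges weakly conditionally to a point of `U` is eventually in `U`. -/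
@[reducible]
def wccTopology : TopologicalSpace Copula3 where
  IsOpen U := ∀ C ∈ U, ∀ Cs : ℕ → Copula3, WCC Cs C → ∀ᶠ n in atTop, Cs n ∈ U
  isOpen_univ := fun _ _ _ _ => Eventually.of_forall fun _ => mem_univ _
  isOpen_inter := fun _ _ hs ht C hC Cs h => (hs C hC.1 Cs h).and (ht C hC.2 Cs h)
  isOpen_sUnion := fun _ hS C ⟨U, hU, hC⟩ Cs h =>
    (hS U hU C hC Cs h).mono fun _ hn => ⟨U, hU, hn⟩

end Copula3

/-- The topology induced by a metric `δ`: a set is open iff it contains, around each of its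
points, a `δ`-ball of positive radius. -/
@[reducible]
def metricTopology {X : Type} (δ : X → X → ℝ) : TopologicalSpace X where
  IsOpen U := ∀ x ∈ U, ∃ r > 0, ∀ y, δ y x < r → y ∈ U
  isOpen_univ := fun _ _ => ⟨1, one_pos, fun _ _ => mem_univ _⟩
  isOpen_inter := fun _ _ hs ht x hx => by
    obtain ⟨r, hr, h⟩ := hs x hx.1
    obtain ⟨r', hr', h'⟩ := ht x hx.2
    exact ⟨min r r', lt_min hr hr', fun y hy =>
      ⟨h y (hy.trans_le (min_le_left _ _)), h' y (hy.trans_le (min_le_right _ _))⟩⟩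
  isOpen_sUnion := fun _ hS x ⟨U, hU, hx⟩ => by
    obtain ⟨r, hr, h⟩ := hS U hU x hx
    exact ⟨r, hr, fun y hy => ⟨U, hU, h y hy⟩⟩

/-- The family of all absolutely continuous trivariate copulas with positive density. -/
abbrev PosDensityCopula3 : Type := {C : Copula3 // C.HasPositiveDensity}

end

/-! Fix `u`. If `C` is simplified, then K_C(t,[0,u]) = A(F₁(u₁|t), F₂(u₂|t)) for almost every t.
Since A is 1-Lipschitz in each argument, |K_C(t,[0,u]) - K_C(s,[0,u])| is at most the sum of the
corresponding differences of the two conditional margins. `lipschitzDefect` is the positive part of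
the violation of this bound; its integral over (t,s) vanishes for simplified copulas
(`IsSimplified.integral_lipschitzDefect_eq_zero`).

Positivity of that integral is an open condition: it involves conditional distribution functions
only at u, (u₁,1) and (1,u₂), in an L¹-continuous way, and L¹ closeness at single points follows
from D₁-closeness (`exists_forall_condDist_lt`) and from weak conditional convergence
(`tendsto_condDist_of_WCC`).

It is also a dense condition (`exists_perturbation`). On a short interval [0,b] the conditional laws
are replaced by two couplings of their averaged margins, the product and a twisted product. The
univariate margins of the copula are preserved, while the two couplings share margins but disagree
at the pair of medians, so the defect is positive. Both couplings are equivalent to Lebesgue measure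
if the original density is positive, so the same argument works inside that class. -/

instance unitInterval.instIsOpenPosMeasure : (volume : Measure I).IsOpenPosMeasure := by
  refine ⟨fun U hU ⟨x, hx⟩ => ?_⟩
  obtain ⟨V, hV, rfl⟩ := isOpen_induced_iff.1 hU
  have hne : (V ∩ Ioo 0 1).Nonempty := by
    refine mem_closure_iff.1 ?_ V hV hx
    rw [closure_Ioo zero_ne_one]
    exact x.2
  rw [unitInterval.volume_apply]
  refine ((hV.inter isOpen_Ioo).measure_pos volume hne).ne' ∘ measure_mono_null ?_
  exact fun y hy => ⟨⟨y, Ioo_subset_Icc_self hy.2⟩, hy.1, rfl⟩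

/-! ### Conditional distribution functions and their L¹ distances -/

namespace Copula3

/-- The conditional joint distribution function `K_C(t, [𝟎, u])`. -/
noncomputable def condCdf (C : Copula3) (u : I × I) (t : I) : ℝ := (C.kernel t).real (Iic u)

/-- The `L¹` distance of the conditional joint distribution functions at `u`. -/
noncomputable def condDist (C D : Copula3) (u : I × I) : ℝ := ∫ t, |C.condCdf u t - D.condCdf u t|

theorem condCdf_nonneg (C : Copula3) (u : I × I) (t : I) : 0 ≤ C.condCdf u t := measureReal_nonneg

theorem condCdf_le_one (C : Copula3) (u : I × I) (t : I) : C.condCdf u t ≤ 1 := measureReal_le_one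

theorem measurable_condCdf (C : Copula3) (u : I × I) : Measurable (C.condCdf u) :=
  (C.kernel.measurable_coe measurableSet_Iic).ennreal_toReal

theorem abs_condCdf_sub_le_one (C D : Copula3) (u : I × I) (t s : I) :
    |C.condCdf u t - D.condCdf u s| ≤ 1 :=
  abs_sub_le_iff.2 ⟨by linarith [C.condCdf_le_one u t, D.condCdf_nonneg u s],
    by linarith [D.condCdf_le_one u s, C.condCdf_nonneg u t]⟩

theorem integrable_condCdf (C : Copula3) (u : I × I) : Integrable (C.condCdf u) :=
  Integrable.of_bound (C.measurable_condCdf u).aestronglyMeasurable 1 <| ae_of_all _ fun t => by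
    rw [Real.norm_eq_abs, abs_of_nonneg (C.condCdf_nonneg u t)]; exact C.condCdf_le_one u t

theorem integrable_abs_condCdf_sub (C D : Copula3) (u : I × I) :
    Integrable fun t => |C.condCdf u t - D.condCdf u t| :=
  ((C.integrable_condCdf u).sub (D.integrable_condCdf u)).abs

theorem F₁_eq_condCdf (C : Copula3) (x t : I) : (C.F₁ x t : ℝ) = C.condCdf (x, 1) t := by
  have : {u : I × I | u.1 ≤ x} = Iic (x, 1) := by
    ext u; simp [Prod.le_def, unitInterval.le_one']
  simp [F₁, condCdf, this]

theorem F₂_eq_condCdf (C : Copula3) (x t : I) : (C.F₂ x t : ℝ) = C.condCdf (1, x) t := by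
  have : {u : I × I | u.2 ≤ x} = Iic (1, x) := by
    ext u; simp [Prod.le_def, unitInterval.le_one']
  simp [F₂, condCdf, this]

theorem fst_map_swap (C : Copula3) : (C.measure.map Prod.swap).fst = volume := by
  rw [Measure.fst, Measure.map_map measurable_fst measurable_swap]
  exact C.map_three

theorem compProd_kernel (C : Copula3) :
    (volume : Measure I) ⊗ₘ C.kernel = C.measure.map Prod.swap := by
  have h := (C.measure.map Prod.swap).disintegrate (C.measure.map Prod.swap).condKernel
  rwa [fst_map_swap] at h

theorem measure_prod_eq_setLIntegral (C : Copula3) {s : Set (I × I)} {t : Set I}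
    (hs : MeasurableSet s) (ht : MeasurableSet t) :
    C.measure (s ×ˢ t) = ∫⁻ x in t, C.kernel x s := by
  rw [← Measure.compProd_apply_prod ht hs, compProd_kernel,
    Measure.map_apply measurable_swap (ht.prod hs), preimage_swap_prod]

theorem measureReal_prod_eq_setIntegral (C : Copula3) {s : Set (I × I)} {t : Set I}
    (hs : MeasurableSet s) (ht : MeasurableSet t) :
    C.measure.real (s ×ˢ t) = ∫ x in t, (C.kernel x).real s := by
  rw [Measure.real, C.measure_prod_eq_setLIntegral hs ht,
    ← integral_toReal (C.kernel.measurable_coe hs).aemeasurable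
      (ae_of_all _ fun x => measure_lt_top _ _)]
  rfl

/-- Two-dimensional doubly stochastic measures have Lipschitz distribution functions. -/
theorem _root_.measureReal_symmDiff_Iic_le {μ : Measure (I × I)} [IsFiniteMeasure μ]
    (h₁ : μ.map Prod.fst = volume) (h₂ : μ.map Prod.snd = volume) (u w : I × I) :
    μ.real (symmDiff (Iic u) (Iic w)) ≤ dist u.1 w.1 + dist u.2 w.2 := by
  -- A point in exactly one of the two boxes has some coordinate between those of `u` and `w`, so it
  -- lies in one of two strips whose mass is given by the uniform margins.
  have hsub : symmDiff (Iic u) (Iic w) ⊆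
      (Prod.fst ⁻¹' uIoc u.1 w.1) ∪ (Prod.snd ⁻¹' uIoc u.2 w.2) := by
    rintro p (⟨h, h'⟩ | ⟨h, h'⟩) <;>
    · simp only [mem_Iic, Prod.le_def, not_and_or, not_le] at h h'
      rcases h' with h' | h'
      · left; simp [mem_uIoc, h', h.1]
      · right; simp [mem_uIoc, h', h.2]
  have e₁ : μ.real (Prod.fst ⁻¹' uIoc u.1 w.1) = dist u.1 w.1 := by
    rw [Measure.real, ← Measure.map_apply measurable_fst measurableSet_uIoc, h₁,
      unitInterval.volume_uIoc, edist_dist, ENNReal.toReal_ofReal dist_nonneg, dist_comm]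
  have e₂ : μ.real (Prod.snd ⁻¹' uIoc u.2 w.2) = dist u.2 w.2 := by
    rw [Measure.real, ← Measure.map_apply measurable_snd measurableSet_uIoc, h₂,
      unitInterval.volume_uIoc, edist_dist, ENNReal.toReal_ofReal dist_nonneg, dist_comm]
  calc _ ≤ _ := measureReal_mono hsub
    _ ≤ _ := measureReal_union_le _ _
    _ = _ := by rw [e₁, e₂]

instance _root_.Copula2.instIsProbabilityMeasure (A : Copula2) :
    IsProbabilityMeasure A.measure := by
  constructor
  have h := congrArg (fun m => m univ) A.map_fst
  simpa [Measure.map_apply measurable_fst MeasurableSet.univ] using h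

theorem _root_.Copula2.abs_cdf_sub_le (A : Copula2) (a b a' b' : I) :
    |A.cdf a b - A.cdf a' b'| ≤ |(a : ℝ) - a'| + |(b : ℝ) - b'| :=
  (abs_measureReal_sub_le_measureReal_symmDiff measurableSet_Iic.nullMeasurableSet
    measurableSet_Iic.nullMeasurableSet).trans
      (measureReal_symmDiff_Iic_le A.map_fst A.map_snd (a, b) (a', b'))

theorem _root_.Copula2.continuous_cdf (A : Copula2) :
    Continuous fun p : I × I => A.cdf p.1 p.2 := by
  refine LipschitzWith.continuous (K := 2) (LipschitzWith.of_dist_le_mul fun p q => ?_)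
  have h := A.abs_cdf_sub_le p.1 p.2 q.1 q.2
  have h₁ : dist p.1 q.1 ≤ dist p q := le_max_left _ _
  have h₂ : dist p.2 q.2 ≤ dist p q := le_max_right _ _
  rw [Subtype.dist_eq, Real.dist_eq] at h₁ h₂
  rw [Real.dist_eq]
  push_cast
  linarith

/-- A single conditional law may have atoms, but averaging over `t` gives the law of the first two
coordinates, whose margins are uniform. -/
theorem integral_abs_condCdf_sub_le (C : Copula3) (u w : I × I) :
    ∫ t, |C.condCdf u t - C.condCdf w t| ≤ dist u.1 w.1 + dist u.2 w.2 := by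
  have hS : MeasurableSet (symmDiff (Iic u) (Iic w)) :=
    measurableSet_Iic.symmDiff measurableSet_Iic
  have h₁ : (C.measure.map Prod.fst).map Prod.fst = volume := by
    rw [Measure.map_map measurable_fst measurable_fst]; exact C.map_one
  have h₂ : (C.measure.map Prod.fst).map Prod.snd = volume := by
    rw [Measure.map_map measurable_snd measurable_fst]; exact C.map_two
  have : IsProbabilityMeasure (C.measure.map Prod.fst) :=
    Measure.isProbabilityMeasure_map measurable_fst.aemeasurable
  calc _ ≤ ∫ t, (C.kernel t).real (symmDiff (Iic u) (Iic w)) := by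
        refine integral_mono ((C.integrable_condCdf u).sub (C.integrable_condCdf w)).abs
          (Integrable.of_bound (C.kernel.measurable_coe hS).ennreal_toReal.aestronglyMeasurable 1
            (ae_of_all _ fun t => ?_)) fun t =>
          abs_measureReal_sub_le_measureReal_symmDiff measurableSet_Iic.nullMeasurableSet
            measurableSet_Iic.nullMeasurableSet
        rw [Real.norm_eq_abs, abs_of_nonneg measureReal_nonneg]
        exact measureReal_le_one
    _ = (C.measure.map Prod.fst).real (symmDiff (Iic u) (Iic w)) := by
        rw [← setIntegral_univ, ← C.measureReal_prod_eq_setIntegral hS MeasurableSet.univ,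
          map_measureReal_apply measurable_fst hS, prod_univ]
    _ ≤ _ := measureReal_symmDiff_Iic_le h₁ h₂ u w

theorem condDist_nonneg (C D : Copula3) (u : I × I) : 0 ≤ C.condDist D u :=
  integral_nonneg fun _ => abs_nonneg _

theorem condDist_le_one (C D : Copula3) (u : I × I) : C.condDist D u ≤ 1 := by
  calc _ ≤ ∫ _ : I, (1 : ℝ) := integral_mono (C.integrable_abs_condCdf_sub D u)
        (integrable_const 1) fun t => abs_condCdf_sub_le_one C D u t t
    _ = 1 := by simp

/-- The constant 4 counts two copulas times two coordinates, each moved by at most `dist u w`. -/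
theorem condDist_le_add (C D : Copula3) (u w : I × I) :
    C.condDist D u ≤ C.condDist D w + 4 * dist u w := by
  have h₁ : dist u.1 w.1 ≤ dist u w := le_max_left _ _
  have h₂ : dist u.2 w.2 ≤ dist u w := le_max_right _ _
  have iC : Integrable fun t => |C.condCdf u t - C.condCdf w t| :=
    ((C.integrable_condCdf u).sub (C.integrable_condCdf w)).abs
  have iD : Integrable fun t => |D.condCdf u t - D.condCdf w t| :=
    ((D.integrable_condCdf u).sub (D.integrable_condCdf w)).abs
  have i := C.integrable_abs_condCdf_sub D w
  have key : C.condDist D u ≤ C.condDist D w + (∫ t, |C.condCdf u t - C.condCdf w t|) +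
      ∫ t, |D.condCdf u t - D.condCdf w t| := by
    unfold condDist
    rw [← integral_add i iC, ← integral_add (i.fun_add iC) iD]
    refine integral_mono (C.integrable_abs_condCdf_sub D u) ((i.add iC).add iD) fun t => ?_
    simp only
    have e : C.condCdf u t - D.condCdf u t = (C.condCdf w t - D.condCdf w t) +
      (C.condCdf u t - C.condCdf w t) - (D.condCdf u t - D.condCdf w t) := by ring
    rw [e]
    exact (abs_sub _ _).trans (add_le_add (abs_add_le _ _) le_rfl)
  linarith [C.integral_abs_condCdf_sub_le u w, D.integral_abs_condCdf_sub_le u w]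

theorem continuous_condDist (C D : Copula3) : Continuous (C.condDist D) := by
  refine LipschitzWith.continuous (K := 4) (LipschitzWith.of_dist_le_mul fun u w => ?_)
  rw [Real.dist_eq, abs_sub_le_iff]
  push_cast
  exact ⟨by linarith [C.condDist_le_add D u w],
    by linarith [C.condDist_le_add D w u, dist_comm u w]⟩

theorem integrable_condDist (C D : Copula3) : Integrable (C.condDist D) :=
  Integrable.of_bound (C.continuous_condDist D).aestronglyMeasurable 1 <| ae_of_all _ fun u => by
    rw [Real.norm_eq_abs, abs_of_nonneg (C.condDist_nonneg D u)]; exact C.condDist_le_one D u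

theorem condDist_le_Dinf (C D : Copula3) (u : I × I) : C.condDist D u ≤ C.Dinf D :=
  le_ciSup (f := C.condDist D) ⟨1, by rintro _ ⟨u, rfl⟩; exact C.condDist_le_one D u⟩ u

theorem D₁_le_Dinf (C D : Copula3) : C.D₁ D ≤ C.Dinf D := by
  calc C.D₁ D = ∫ u, C.condDist D u := rfl
    _ ≤ ∫ _ : I × I, C.Dinf D := integral_mono (C.integrable_condDist D) (integrable_const _)
        fun u => C.condDist_le_Dinf D u
    _ = _ := by simp

/-- By the 4-Lipschitz bound, a value of at least ε at `u` forces at least ε/2 on the ball of radius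
ε/8, which has positive volume even for `u` on the boundary. The resulting `r` is uniform in `C` and
`D`. -/
theorem exists_forall_condDist_lt (u : I × I) {ε : ℝ} (hε : 0 < ε) :
    ∃ r > 0, ∀ C D : Copula3, C.D₁ D < r → C.condDist D u < ε := by
  have hpos : 0 < (volume : Measure (I × I)).real (Metric.ball u (ε / 8)) :=
    ENNReal.toReal_pos (Metric.measure_ball_pos _ _ (by positivity)).ne' (measure_ne_top _ _)
  refine ⟨ε / 2 * (volume : Measure (I × I)).real (Metric.ball u (ε / 8)), by positivity,
    fun C D h => ?_⟩
  by_contra! hc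
  refine h.not_ge ?_
  calc _ = ∫ _ in Metric.ball u (ε / 8), ε / 2 := by simp [mul_comm]
    _ ≤ ∫ w in Metric.ball u (ε / 8), C.condDist D w := by
        refine setIntegral_mono_on (integrable_const _) (C.integrable_condDist D).integrableOn
          Metric.isOpen_ball.measurableSet fun w hw => ?_
        rw [Metric.mem_ball, dist_comm] at hw
        linarith [C.condDist_le_add D u w]
    _ ≤ ∫ w, C.condDist D w := setIntegral_le_integral (C.integrable_condDist D)
        (ae_of_all _ fun w => C.condDist_nonneg D w)

/-- The boundary of [0,u] lies in two lines that are null by uniformity of the margins, hence null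
for almost every conditional law. The portmanteau theorem and dominated convergence then apply. -/
theorem tendsto_condDist_of_WCC {Cs : ℕ → Copula3} {C : Copula3} (h : WCC Cs C) (u : I × I) :
    Tendsto (fun n => (Cs n).condDist C u) atTop (𝓝 0) := by
  have hfr : ∀ᵐ t : I, C.kernel t (frontier (Iic u)) = 0 := by
    have hm : MeasurableSet (frontier (Iic u) : Set (I × I)) := isClosed_frontier.measurableSet
    have hsub : frontier (Iic u : Set (I × I)) ⊆ Prod.fst ⁻¹' {u.1} ∪ Prod.snd ⁻¹' {u.2} := by
      rw [← Prod.mk.eta (p := u), ← Iic_prod_Iic, frontier_prod_eq]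
      rintro p (hp | hp)
      · exact Or.inr (frontier_Iic_subset _ hp.2)
      · exact Or.inl (frontier_Iic_subset _ hp.1)
    have h0 : C.measure (frontier (Iic u) ×ˢ univ) = 0 := by
      have h₁ : C.measure ((fun p => p.1.1) ⁻¹' {u.1}) = 0 := by
        rw [← Measure.map_apply (by fun_prop) (measurableSet_singleton _), C.map_one]; simp
      have h₂ : C.measure ((fun p => p.1.2) ⁻¹' {u.2}) = 0 := by
        rw [← Measure.map_apply (by fun_prop) (measurableSet_singleton _), C.map_two]; simp
      refine measure_mono_null (fun p hp => ?_) (measure_union_null h₁ h₂)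
      exact hsub hp.1
    rw [C.measure_prod_eq_setLIntegral hm MeasurableSet.univ, setLIntegral_univ,
      lintegral_eq_zero_iff (C.kernel.measurable_coe hm)] at h0
    exact h0
  rw [← integral_zero I ℝ (μ := volume)]
  refine tendsto_integral_of_dominated_convergence (fun _ => 1)
    (fun n => ((Cs n).integrable_abs_condCdf_sub C u).aestronglyMeasurable) (integrable_const 1)
    (fun n => ae_of_all _ fun t => ?_) ?_
  · rw [Real.norm_eq_abs, abs_abs]; exact abs_condCdf_sub_le_one _ _ _ _ _
  · filter_upwards [h, hfr] with t ht ht0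
    have := ProbabilityMeasure.tendsto_measure_of_null_frontier_of_tendsto' ht ht0
    have := (ENNReal.tendsto_toReal (measure_ne_top _ _)).comp this
    rw [← tendsto_sub_nhds_zero_iff] at this
    exact (tendsto_zero_iff_abs_tendsto_zero _).1 this

/-! ### The Lipschitz defect -/

/-- The amount by which the joint conditional distribution functions at `u` for two values of the
conditioning variable violate the Lipschitz bound that a common conditional copula imposes. -/
noncomputable def lipschitzDefect (C : Copula3) (u : I × I) (p : I × I) : ℝ :=
  max 0 (|C.condCdf u p.1 - C.condCdf u p.2| - |C.condCdf (u.1, 1) p.1 - C.condCdf (u.1, 1) p.2| -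
    |C.condCdf (1, u.2) p.1 - C.condCdf (1, u.2) p.2|)

theorem measurable_lipschitzDefect (C : Copula3) (u : I × I) :
    Measurable (C.lipschitzDefect u) := by
  have h := C.measurable_condCdf
  unfold lipschitzDefect
  fun_prop

theorem lipschitzDefect_nonneg (C : Copula3) (u p : I × I) : 0 ≤ C.lipschitzDefect u p :=
  le_max_left _ _

theorem lipschitzDefect_le_one (C : Copula3) (u p : I × I) : C.lipschitzDefect u p ≤ 1 :=
  max_le zero_le_one <| by
    linarith [abs_condCdf_sub_le_one C C u p.1 p.2,
      abs_nonneg (C.condCdf (u.1, 1) p.1 - C.condCdf (u.1, 1) p.2),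
      abs_nonneg (C.condCdf (1, u.2) p.1 - C.condCdf (1, u.2) p.2)]

theorem integrable_lipschitzDefect (C : Copula3) (u : I × I) :
    Integrable (C.lipschitzDefect u) :=
  Integrable.of_bound (C.measurable_lipschitzDefect u).aestronglyMeasurable 1 <|
    ae_of_all _ fun p => by
      rw [Real.norm_eq_abs, abs_of_nonneg (C.lipschitzDefect_nonneg u p)]
      exact C.lipschitzDefect_le_one u p

theorem abs_sub_sub_abs_sub_le (a b c d : ℝ) : |(|a - b| - |c - d|)| ≤ |a - c| + |b - d| :=
  (abs_abs_sub_abs_le _ _).trans <| by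
    rw [show a - b - (c - d) = (a - c) - (b - d) by ring]; exact abs_sub _ _

theorem lipschitzDefect_sub_le (C D : Copula3) (u p : I × I) :
    C.lipschitzDefect u p - D.lipschitzDefect u p ≤
      (|C.condCdf u p.1 - D.condCdf u p.1| + |C.condCdf (u.1, 1) p.1 - D.condCdf (u.1, 1) p.1| +
        |C.condCdf (1, u.2) p.1 - D.condCdf (1, u.2) p.1|) +
      (|C.condCdf u p.2 - D.condCdf u p.2| + |C.condCdf (u.1, 1) p.2 - D.condCdf (u.1, 1) p.2| +
        |C.condCdf (1, u.2) p.2 - D.condCdf (1, u.2) p.2|) := by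
  have key := fun w => abs_le.1 <| abs_sub_sub_abs_sub_le (C.condCdf w p.1) (C.condCdf w p.2)
    (D.condCdf w p.1) (D.condCdf w p.2)
  have h₀ := key u
  have h₁ := key (u.1, 1)
  have h₂ := key (1, u.2)
  rw [sub_le_iff_le_add']
  refine max_le ?_ ?_
  · have := D.lipschitzDefect_nonneg u p
    positivity
  · have : _ ≤ D.lipschitzDefect u p := le_max_right _ _
    linarith [h₀.2, h₁.1, h₂.1]

theorem integral_lipschitzDefect_le_add (C D : Copula3) (u : I × I) :
    ∫ p, C.lipschitzDefect u p ≤ (∫ p, D.lipschitzDefect u p) +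
      2 * (C.condDist D u + C.condDist D (u.1, 1) + C.condDist D (1, u.2)) := by
  -- The pointwise bound is `f p.1 + f p.2`; each summand integrates to the sum of the three
  -- distances, whence the factor 2.
  let f : I → ℝ := fun t => |C.condCdf u t - D.condCdf u t| +
    |C.condCdf (u.1, 1) t - D.condCdf (u.1, 1) t| + |C.condCdf (1, u.2) t - D.condCdf (1, u.2) t|
  have i₀ := C.integrable_abs_condCdf_sub D u
  have i₁ := C.integrable_abs_condCdf_sub D (u.1, 1)
  have i₂ := C.integrable_abs_condCdf_sub D (1, u.2)
  have hf : Integrable f := (i₀.add i₁).add i₂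
  have hI : ∫ t, f t = C.condDist D u + C.condDist D (u.1, 1) + C.condDist D (1, u.2) := by
    simp only [f]
    rw [integral_add (i₀.fun_add i₁) i₂, integral_add i₀ i₁]
    rfl
  have hf₁ : Integrable fun p : I × I => f p.1 := hf.comp_fst _
  have hf₂ : Integrable fun p : I × I => f p.2 := hf.comp_snd _
  have := integral_mono (μ := (volume : Measure (I × I)))
    ((C.integrable_lipschitzDefect u).sub (D.integrable_lipschitzDefect u))
    (hf₁.add hf₂) (fun p => C.lipschitzDefect_sub_le D u p)
  simp only [Pi.sub_apply, Pi.add_apply] at this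
  rw [integral_sub (C.integrable_lipschitzDefect u) (D.integrable_lipschitzDefect u),
    integral_add hf₁ hf₂] at this
  have e₁ : ∫ p : I × I, f p.1 = ∫ t, f t := by
    rw [Measure.volume_eq_prod, integral_fun_fst, probReal_univ, one_smul]
  have e₂ : ∫ p : I × I, f p.2 = ∫ t, f t := by
    rw [Measure.volume_eq_prod, integral_fun_snd, probReal_univ, one_smul]
  linarith

/-- Integrals over all [0,v] determine the integrand almost everywhere: both sides are densities of
the same finite measure. The null set may depend on `u`, which is harmless because the defect is
taken at fixed `u`. -/
theorem IsGeneralizedSimplified.condCdf_eq {C : Copula3} {A : Copula2}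
    (h : ∀ (u : I × I) (v : I), C.cdf u v = ∫ t in Iic v, A.cdf (C.F₁ u.1 t) (C.F₂ u.2 t))
    (u : I × I) : ∀ᵐ t, C.condCdf u t = A.cdf (C.F₁ u.1 t) (C.F₂ u.2 t) := by
  have m₁ : Measurable (C.F₁ u.1) := by
    refine Measurable.subtype_mk (C.kernel.measurable_coe ?_).ennreal_toReal
    exact measurableSet_le measurable_fst measurable_const
  have m₂ : Measurable (C.F₂ u.2) := by
    refine Measurable.subtype_mk (C.kernel.measurable_coe ?_).ennreal_toReal
    exact measurableSet_le measurable_snd measurable_const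
  have mA : Measurable fun t => A.cdf (C.F₁ u.1 t) (C.F₂ u.2 t) :=
    A.continuous_cdf.measurable.comp (m₁.prodMk m₂)
  have iA : Integrable fun t => A.cdf (C.F₁ u.1 t) (C.F₂ u.2 t) :=
    Integrable.of_bound mA.aestronglyMeasurable 1 <| ae_of_all _ fun t => by
      rw [Real.norm_eq_abs, Copula2.cdf, abs_of_nonneg measureReal_nonneg]
      exact measureReal_le_one
  have iC := C.integrable_condCdf u
  have hw : (volume : Measure I).withDensity (fun t => ENNReal.ofReal (C.condCdf u t)) =
      volume.withDensity fun t => ENNReal.ofReal (A.cdf (C.F₁ u.1 t) (C.F₂ u.2 t)) := by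
    have := isFiniteMeasure_withDensity_ofReal iC.2
    refine Measure.ext_of_Iic _ _ fun v => ?_
    rw [withDensity_apply _ measurableSet_Iic, withDensity_apply _ measurableSet_Iic,
      ← ofReal_integral_eq_lintegral_ofReal iC.restrict
        (ae_of_all _ fun t => C.condCdf_nonneg u t),
      ← ofReal_integral_eq_lintegral_ofReal iA.restrict
        (ae_of_all _ fun t => measureReal_nonneg), ← h u v, cdf, ← Iic_prod_Iic,
      C.measureReal_prod_eq_setIntegral measurableSet_Iic measurableSet_Iic]
    rfl
  rw [withDensity_eq_iff iC.1.aemeasurable.ennreal_ofReal mA.ennreal_ofReal.aemeasurable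
    (by
      rw [← ofReal_integral_eq_lintegral_ofReal iC (ae_of_all _ fun t => C.condCdf_nonneg u t)]
      exact ENNReal.ofReal_ne_top)] at hw
  filter_upwards [hw] with t ht
  exact (ENNReal.ofReal_eq_ofReal_iff (C.condCdf_nonneg u t) measureReal_nonneg).1 ht

theorem IsSimplified.integral_lipschitzDefect_eq_zero {C : Copula3} (hC : C.IsSimplified)
    (u : I × I) : ∫ p, C.lipschitzDefect u p = 0 := by
  obtain ⟨⟨A, hA⟩, -⟩ := hC
  have h := IsGeneralizedSimplified.condCdf_eq hA u
  refine integral_eq_zero_of_ae ?_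
  have h₁ : ∀ᵐ p : I × I, C.condCdf u p.1 = A.cdf (C.F₁ u.1 p.1) (C.F₂ u.2 p.1) :=
    Measure.quasiMeasurePreserving_fst.ae h
  have h₂ : ∀ᵐ p : I × I, C.condCdf u p.2 = A.cdf (C.F₁ u.1 p.2) (C.F₂ u.2 p.2) :=
    Measure.quasiMeasurePreserving_snd.ae h
  filter_upwards [h₁, h₂] with p hp₁ hp₂
  refine max_eq_left ?_
  have := A.abs_cdf_sub_le (C.F₁ u.1 p.1) (C.F₂ u.2 p.1) (C.F₁ u.1 p.2) (C.F₂ u.2 p.2)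
  rw [hp₁, hp₂]
  simp only [F₁_eq_condCdf, F₂_eq_condCdf] at this
  linarith

end Copula3

/-! ### Medians and the twisted coupling -/

/-- A probability measure dominated by a multiple of the uniform distribution has a median. -/
theorem exists_measure_Iic_eq_half {μ : Measure I} [IsProbabilityMeasure μ] {c : ℝ≥0∞}
    (hc : c ≠ ∞) (h : μ ≤ c • volume) : ∃ m, μ (Iic m) = 1 / 2 := by
  have hcont : Continuous fun x => μ.real (Iic x) := by
    refine LipschitzWith.continuous (K := c.toNNReal) (LipschitzWith.of_dist_le_mul fun x y => ?_)
    rw [Real.dist_eq]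
    refine (abs_measureReal_sub_le_measureReal_symmDiff measurableSet_Iic.nullMeasurableSet
      measurableSet_Iic.nullMeasurableSet).trans ?_
    have hsub : symmDiff (Iic x) (Iic y) ⊆ uIoc x y := by
      rintro p (⟨h, h'⟩ | ⟨h, h'⟩) <;>
      · simp only [mem_Iic, not_le] at h h'
        simp [mem_uIoc, h, h']
    refine (measureReal_mono hsub).trans ?_
    have h' : μ (uIoc x y) ≤ c * edist y x := by
      simpa using h (uIoc x y)
    have := ENNReal.toReal_mono (ENNReal.mul_ne_top hc (edist_ne_top _ _)) h'
    rwa [ENNReal.toReal_mul, edist_dist, ENNReal.toReal_ofReal dist_nonneg, dist_comm] at this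
  have h0 : μ.real (Iic 0) = 0 := by
    have : μ (Iic 0) ≤ 0 := by simpa using h (Iic 0)
    simp [Measure.real, le_antisymm this bot_le]
  have h1 : μ.real (Iic 1) = 1 := by
    have : (Iic 1 : Set I) = univ := eq_univ_of_forall fun x => unitInterval.le_one'
    simp [this]
  obtain ⟨m, hm⟩ := mem_range_of_exists_le_of_exists_ge (c := 1 / 2) hcont
    ⟨0, by rw [h0]; norm_num⟩ ⟨1, by rw [h1]; norm_num⟩
  refine ⟨m, ?_⟩
  replace hm : μ.real (Iic m) = 1 / 2 := hm
  rw [← ofReal_measureReal, hm, ENNReal.ofReal_div_of_pos two_pos]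
  simp

/-- The coupling of `μ` and `ν` whose density with respect to `μ.prod ν` is larger where both
coordinates lie on the same side of `m` and `n`, respectively. -/
noncomputable def twistedProd (μ ν : Measure I) (m n : I) : Measure (I × I) :=
  (1 / 2 : ℝ≥0∞) • μ.prod ν + (μ.restrict (Iic m)).prod (ν.restrict (Iic n)) +
    (μ.restrict (Ioi m)).prod (ν.restrict (Ioi n))

section twistedProd

variable {μ ν : Measure I} {m n : I}

theorem measure_Ioi_eq_half [IsProbabilityMeasure μ] (hm : μ (Iic m) = 1 / 2) : μ (Ioi m) = 1 / 2 := by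
  rw [← compl_Iic, prob_compl_eq_one_sub measurableSet_Iic, hm]
  simp

/-- Mass balance for the margins of `twistedProd`: each diagonal block carries the factor 1/2, the
mass of a half-line cut at the median of the other coordinate. -/
theorem half_mul_add_measure_mul_half (μ : Measure I) (m : I) {s : Set I} :
    1 / 2 * μ s + μ (s ∩ Iic m) * (1 / 2) + μ (s ∩ Ioi m) * (1 / 2) = μ s := by
  have : μ (s ∩ Iic m) + μ (s ∩ Ioi m) = μ s := by
    rw [← compl_Iic, ← sdiff_eq]
    exact measure_inter_add_sdiff s measurableSet_Iic
  rw [add_assoc, ← add_mul, this, mul_comm, ← mul_add, one_div, ENNReal.inv_two_add_inv_two,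
    mul_one]

theorem twistedProd_fst_preimage [IsProbabilityMeasure ν] (hn : ν (Iic n) = 1 / 2) {s : Set I}
    (hs : MeasurableSet s) :
    twistedProd μ ν m n (Prod.fst ⁻¹' s) = μ s := by
  rw [← prod_univ]
  simp [twistedProd, Measure.prod_prod, Measure.restrict_apply hs, hn, measure_Ioi_eq_half hn,
    -one_div, half_mul_add_measure_mul_half]

theorem twistedProd_snd_preimage [IsProbabilityMeasure μ] [IsProbabilityMeasure ν]
    (hm : μ (Iic m) = 1 / 2) {s : Set I} (hs : MeasurableSet s) :
    twistedProd μ ν m n (Prod.snd ⁻¹' s) = ν s := by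
  rw [← univ_prod]
  simp [twistedProd, Measure.prod_prod, Measure.restrict_apply hs, hm, measure_Ioi_eq_half hm,
    -one_div, mul_comm (1 / 2) (ν (_ ∩ _)), half_mul_add_measure_mul_half]

theorem isProbabilityMeasure_twistedProd [IsProbabilityMeasure μ] [IsProbabilityMeasure ν]
    (hn : ν (Iic n) = 1 / 2) :
    IsProbabilityMeasure (twistedProd μ ν m n) :=
  ⟨by simpa using twistedProd_fst_preimage (m := m) (μ := μ) hn MeasurableSet.univ⟩

theorem prod_real_Iic_eq [SFinite ν] (hm : μ (Iic m) = 1 / 2) (hn : ν (Iic n) = 1 / 2) :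
    (μ.prod ν).real (Iic (m, n)) = 1 / 4 := by
  rw [Measure.real, ← Iic_prod_Iic, Measure.prod_prod, hm, hn, ENNReal.toReal_mul]
  norm_num

/-- The lower block has density 1/2 + 1 with respect to the product, and (3/2)·(1/4) = 3/8; the
product itself gives 1/4. -/
theorem twistedProd_real_Iic_eq [SFinite ν] (hm : μ (Iic m) = 1 / 2) (hn : ν (Iic n) = 1 / 2) :
    (twistedProd μ ν m n).real (Iic (m, n)) = 3 / 8 := by
  have h : (Iic m ∩ Ioi m : Set I) = ∅ := by rw [← compl_Iic, inter_compl_self]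
  have : twistedProd μ ν m n (Iic (m, n)) = 1 / 2 * (1 / 2 * (1 / 2)) + 1 / 2 * (1 / 2) := by
    rw [← Iic_prod_Iic]
    simp only [twistedProd, Measure.add_apply, Measure.smul_apply, smul_eq_mul, Measure.prod_prod,
      Measure.restrict_apply measurableSet_Iic, inter_self, hm, hn, h, measure_empty, zero_mul,
      add_zero]
  rw [Measure.real, this, ENNReal.toReal_add (by finiteness) (by finiteness)]
  simp only [ENNReal.toReal_mul, ENNReal.toReal_div]
  norm_num

theorem twistedProd_absolutelyContinuous [SFinite ν] : twistedProd μ ν m n ≪ μ.prod ν := by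
  refine Measure.AbsolutelyContinuous.add_left (Measure.AbsolutelyContinuous.add_left ?_ ?_) ?_
  · exact Measure.smul_absolutelyContinuous
  · exact Measure.restrict_le_self.absolutelyContinuous.prod
      Measure.restrict_le_self.absolutelyContinuous
  · exact Measure.restrict_le_self.absolutelyContinuous.prod
      Measure.restrict_le_self.absolutelyContinuous

/-- The summand `(1 / 2) • μ.prod ν` keeps the density positive off the diagonal blocks. -/
theorem absolutelyContinuous_twistedProd : μ.prod ν ≪ twistedProd μ ν m n := by
  refine fun s hs => ?_
  simp only [twistedProd, Measure.add_apply, add_eq_zero, Measure.smul_apply, smul_eq_mul,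
    mul_eq_zero] at hs
  exact hs.1.1.resolve_left (by simp)

end twistedProd

/-! ### Perturbing the conditional laws of a copula -/

namespace Copula3

/-- The copula with a prescribed regular conditional distribution. -/
noncomputable def ofKernel (κ : Kernel I (I × I)) [IsMarkovKernel κ]
    (h₁ : ∀ s, MeasurableSet s → ∫⁻ t, κ t (Prod.fst ⁻¹' s) = volume s)
    (h₂ : ∀ s, MeasurableSet s → ∫⁻ t, κ t (Prod.snd ⁻¹' s) = volume s) : Copula3 where
  measure := ((volume : Measure I) ⊗ₘ κ).map Prod.swap
  map_one := by
    rw [Measure.map_map (by fun_prop) measurable_swap]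
    ext s hs
    rw [Measure.map_apply (by fun_prop) hs, Measure.compProd_apply (by measurability), ← h₁ s hs]
    rfl
  map_two := by
    rw [Measure.map_map (by fun_prop) measurable_swap]
    ext s hs
    rw [Measure.map_apply (by fun_prop) hs, Measure.compProd_apply (by measurability), ← h₂ s hs]
    rfl
  map_three := by
    rw [Measure.map_map (by fun_prop) measurable_swap]
    exact Measure.fst_compProd _ _

theorem kernel_ofKernel (κ : Kernel I (I × I)) [IsMarkovKernel κ]
    (h₁ : ∀ s, MeasurableSet s → ∫⁻ t, κ t (Prod.fst ⁻¹' s) = volume s)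
    (h₂ : ∀ s, MeasurableSet s → ∫⁻ t, κ t (Prod.snd ⁻¹' s) = volume s) :
    ∀ᵐ t, (ofKernel κ h₁ h₂).kernel t = κ t := by
  have hsw : (ofKernel κ h₁ h₂).measure.map Prod.swap = volume ⊗ₘ κ := by
    rw [ofKernel, Measure.map_map measurable_swap measurable_swap, Prod.swap_swap_eq,
      Measure.map_id]
  have h := eq_condKernel_of_measure_eq_compProd
    (ρ := (ofKernel κ h₁ h₂).measure.map Prod.swap) κ (by rw [fst_map_swap, hsw])
  rw [fst_map_swap] at h
  filter_upwards [h] with t ht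
  exact ht.symm

/-- A positive density means mutual absolute continuity with Lebesgue measure. After swapping,
Lebesgue measure disintegrates into a constant kernel, so this can be tested on almost every
conditional law. -/
theorem hasPositiveDensity_iff (C : Copula3) :
    C.HasPositiveDensity ↔ ∀ᵐ t, C.kernel t ≪ volume ∧ volume ≪ C.kernel t := by
  have hvol : (volume : Measure ((I × I) × I)).map Prod.swap =
      (volume : Measure I) ⊗ₘ Kernel.const I volume := by
    rw [Measure.compProd_const, Measure.volume_eq_prod, Measure.prod_swap]
  have swap_ac {α β : Type} [MeasurableSpace α] [MeasurableSpace β] {μ ν : Measure (α × β)} :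
      μ.map Prod.swap ≪ ν.map Prod.swap ↔ μ ≪ ν := by
    refine ⟨fun h => ?_, fun h => h.map measurable_swap⟩
    have := h.map (measurable_swap (α := β) (β := α))
    rwa [Measure.map_map measurable_swap measurable_swap,
      Measure.map_map measurable_swap measurable_swap, Prod.swap_swap_eq, Measure.map_id,
      Measure.map_id] at this
  have hac : (C.measure ≪ volume ∧ volume ≪ C.measure) ↔
      ∀ᵐ t, C.kernel t ≪ volume ∧ volume ≪ C.kernel t := by
    rw [← swap_ac, ← swap_ac (ν := C.measure), hvol, ← compProd_kernel,
      Measure.absolutelyContinuous_compProd_right_iff,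
      Measure.absolutelyContinuous_compProd_right_iff, ← eventually_and]
    simp
  rw [← hac]
  constructor
  · rintro ⟨c, hc, hpos, h⟩
    rw [h]
    exact ⟨withDensity_absolutelyContinuous _ _, withDensity_absolutelyContinuous' hc.aemeasurable
      (hpos.mono fun p hp => hp.ne')⟩
  · rintro ⟨h, h'⟩
    exact ⟨C.measure.rnDeriv volume, Measure.measurable_rnDeriv _ _, Measure.rnDeriv_pos' h',
      (Measure.withDensity_rnDeriv_eq _ _ h).symm⟩

/-- The average of the conditional laws over `[0, b]`. -/
noncomputable def averageLaw (C : Copula3) (b : I) : Measure (I × I) :=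
  (ENNReal.ofReal b)⁻¹ • (C.measure.restrict (univ ×ˢ Iic b)).map Prod.fst

section averageLaw

variable {C : Copula3} {b : I}

theorem averageLaw_apply {s : Set (I × I)} (hs : MeasurableSet s) :
    C.averageLaw b s = (ENNReal.ofReal b)⁻¹ * ∫⁻ t in Iic b, C.kernel t s := by
  rw [averageLaw, Measure.smul_apply, Measure.map_apply measurable_fst hs,
    Measure.restrict_apply (measurable_fst hs), ← C.measure_prod_eq_setLIntegral hs
    measurableSet_Iic, ← prod_univ, prod_inter_prod, inter_univ, univ_inter, smul_eq_mul]

theorem ofReal_mul_averageLaw (hb : 0 < b) {s : Set (I × I)} (hs : MeasurableSet s) :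
    ENNReal.ofReal b * C.averageLaw b s = ∫⁻ t in Iic b, C.kernel t s := by
  rw [averageLaw_apply hs, ← mul_assoc, ENNReal.mul_inv_cancel _ ENNReal.ofReal_ne_top, one_mul]
  simpa using hb

theorem isProbabilityMeasure_averageLaw (hb : 0 < b) : IsProbabilityMeasure (C.averageLaw b) := by
  constructor
  rw [averageLaw_apply MeasurableSet.univ]
  simp only [measure_univ, lintegral_one, Measure.restrict_apply, MeasurableSet.univ, univ_inter,
    unitInterval.volume_Iic]
  exact ENNReal.inv_mul_cancel (by simpa using hb) ENNReal.ofReal_ne_top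

/-- Restricting to a slab only decreases the uniform margin, so normalizing gives a density of at
most 1/b. This supplies the median and absolute continuity. -/
theorem averageLaw_map_fst_le :
    (C.averageLaw b).map Prod.fst ≤ (ENNReal.ofReal b)⁻¹ • volume := by
  rw [averageLaw, Measure.map_smul, Measure.map_map measurable_fst measurable_fst, ← C.map_one]
  gcongr
  · exact Measure.map_mono Measure.restrict_le_self (by fun_prop)

theorem averageLaw_map_snd_le :
    (C.averageLaw b).map Prod.snd ≤ (ENNReal.ofReal b)⁻¹ • volume := by
  rw [averageLaw, Measure.map_smul, Measure.map_map measurable_snd measurable_fst, ← C.map_two]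
  gcongr
  · exact Measure.map_mono Measure.restrict_le_self (by fun_prop)

theorem volume_absolutelyContinuous_averageLaw (hb : 0 < b)
    (hC : ∀ᵐ t, volume ≪ C.kernel t) : volume ≪ C.averageLaw b := by
  refine Measure.AbsolutelyContinuous.mk fun s hs h0 => ?_
  have h := ofReal_mul_averageLaw (C := C) hb hs
  rw [h0, mul_zero, eq_comm, lintegral_eq_zero_iff (C.kernel.measurable_coe hs)] at h
  have : NeZero ((volume : Measure I).restrict (Iic b)) := ⟨by simpa using hb⟩
  obtain ⟨t, ht, ht'⟩ := (h.and (ae_restrict_of_ae hC)).exists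
  exact ht' ht

end averageLaw

/-- Replacing the conditional laws on `[0, b]` by two different couplings of their averaged
margins destroys simplifiedness. -/
theorem exists_perturbation (C : Copula3) {b : I} (hb : 0 < b) :
    ∃ D : Copula3, (∀ᵐ t, b < t → D.kernel t = C.kernel t) ∧
      (∃ u, 0 < ∫ p, D.lipschitzDefect u p) ∧ (C.HasPositiveDensity → D.HasPositiveDensity) := by
  obtain ⟨a, ha, hab⟩ := exists_between hb
  have hb' : (ENNReal.ofReal b)⁻¹ ≠ ∞ := by simpa using hb
  have := isProbabilityMeasure_averageLaw (C := C) hb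
  obtain ⟨μ, hμ⟩ : ∃ μ, μ = (C.averageLaw b).map Prod.fst := ⟨_, rfl⟩
  obtain ⟨ν, hν⟩ : ∃ ν, ν = (C.averageLaw b).map Prod.snd := ⟨_, rfl⟩
  have hμp : IsProbabilityMeasure μ :=
    hμ ▸ Measure.isProbabilityMeasure_map measurable_fst.aemeasurable
  have hνp : IsProbabilityMeasure ν :=
    hν ▸ Measure.isProbabilityMeasure_map measurable_snd.aemeasurable
  obtain ⟨m, hm⟩ := exists_measure_Iic_eq_half hb' (hμ.trans_le averageLaw_map_fst_le)
  obtain ⟨n, hn⟩ := exists_measure_Iic_eq_half hb' (hν.trans_le averageLaw_map_snd_le)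
  have htp : IsProbabilityMeasure (twistedProd μ ν m n) := isProbabilityMeasure_twistedProd hn
  let κ : Kernel I (I × I) := Kernel.piecewise (measurableSet_Iic (a := a))
    (Kernel.const I (twistedProd μ ν m n))
    (Kernel.piecewise (measurableSet_Iic (a := b)) (Kernel.const I (μ.prod ν)) C.kernel)
  have hκ₁ : ∀ t ≤ a, κ t = twistedProd μ ν m n := fun t ht => by
    simp [κ, Kernel.piecewise_apply, ht]
  have hκ₂ : ∀ t, a < t → t ≤ b → κ t = μ.prod ν := fun t ht ht' => by
    simp [κ, Kernel.piecewise_apply, ht, ht']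
  have hκ₃ : ∀ t, b < t → κ t = C.kernel t := fun t ht => by
    simp [κ, Kernel.piecewise_apply, ht.not_ge, (hab.trans ht).not_ge]
  have hκ : IsMarkovKernel κ := inferInstance
  -- If the new laws on [0,b] give `s` its average mass there, the total mass of `s` is unchanged.
  -- It is applied to preimages of sets under the two coordinate projections.
  have margin {s : Set (I × I)} (hs : MeasurableSet s)
      (hs' : ∀ t ≤ b, κ t s = C.averageLaw b s) : ∫⁻ t, κ t s = ∫⁻ t, C.kernel t s := by
    rw [← lintegral_add_compl _ (measurableSet_Iic (a := b)),
      ← lintegral_add_compl (fun t => C.kernel t s) (measurableSet_Iic (a := b)),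
      setLIntegral_congr_fun measurableSet_Iic hs', setLIntegral_const, unitInterval.volume_Iic,
      mul_comm, ofReal_mul_averageLaw hb hs]
    congr 1
    refine setLIntegral_congr_fun measurableSet_Iic.compl fun t ht => ?_
    rw [hκ₃ t (by simpa using ht)]
  have h₁ : ∀ s, MeasurableSet s → ∫⁻ t, κ t (Prod.fst ⁻¹' s) = volume s := fun s hs => by
    rw [margin (measurable_fst hs) fun t ht => ?_, ← setLIntegral_univ,
      ← C.measure_prod_eq_setLIntegral (measurable_fst hs) MeasurableSet.univ, ← C.map_one,
      Measure.map_apply (by fun_prop) hs, prod_univ, preimage_preimage]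
    rw [← Measure.map_apply (μ := C.averageLaw b) measurable_fst hs, ← hμ]
    rcases le_or_gt t a with hta | hta
    · rw [hκ₁ t hta, twistedProd_fst_preimage hn hs]
    · rw [hκ₂ t hta ht, ← prod_univ, Measure.prod_prod, measure_univ, mul_one]
  have h₂ : ∀ s, MeasurableSet s → ∫⁻ t, κ t (Prod.snd ⁻¹' s) = volume s := fun s hs => by
    rw [margin (measurable_snd hs) fun t ht => ?_, ← setLIntegral_univ,
      ← C.measure_prod_eq_setLIntegral (measurable_snd hs) MeasurableSet.univ, ← C.map_two,
      Measure.map_apply (by fun_prop) hs, prod_univ, preimage_preimage]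
    rw [← Measure.map_apply (μ := C.averageLaw b) measurable_snd hs, ← hν]
    rcases le_or_gt t a with hta | hta
    · rw [hκ₁ t hta, twistedProd_snd_preimage hm hs]
    · rw [hκ₂ t hta ht, ← univ_prod, Measure.prod_prod, measure_univ, one_mul]
  have hD := kernel_ofKernel κ h₁ h₂
  refine ⟨ofKernel κ h₁ h₂, ?_, ⟨(m, n), ?_⟩, ?_⟩
  · filter_upwards [hD] with t ht hbt
    rw [ht, hκ₃ t hbt]
  · set D := ofKernel κ h₁ h₂
    refine lt_of_le_of_ne (integral_nonneg fun p => D.lipschitzDefect_nonneg _ p) fun h0 => ?_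
    rw [eq_comm, integral_eq_zero_iff_of_nonneg (fun p => D.lipschitzDefect_nonneg _ p)
      (D.integrable_lipschitzDefect _)] at h0
    -- For almost all pairs in this box the marginal terms of the defect cancel, leaving 3/8 - 1/4 =
    -- 1/8; a null defect would make the box null.
    have hbox : (volume : Measure (I × I)) (Iic a ×ˢ Ioc a b) ≠ 0 := by
      rw [Measure.volume_eq_prod, Measure.prod_prod]
      simpa using ⟨ha, hab⟩
    refine hbox (measure_mono_null ?_ (ae_iff.1 ((h0.and
      (Measure.quasiMeasurePreserving_fst.ae hD)).and (Measure.quasiMeasurePreserving_snd.ae hD))))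
    rintro p ⟨hp₁, hp₂⟩ ⟨⟨hp, hf⟩, hs⟩
    have e₁ : D.kernel p.1 = twistedProd μ ν m n := hf.trans (hκ₁ _ hp₁)
    have e₂ : D.kernel p.2 = μ.prod ν := hs.trans (hκ₂ _ hp₂.1 hp₂.2)
    have I₁ : (Iic (m, 1) : Set (I × I)) = Prod.fst ⁻¹' Iic m := by
      ext u; simp [Prod.le_def, unitInterval.le_one']
    have I₂ : (Iic (1, n) : Set (I × I)) = Prod.snd ⁻¹' Iic n := by
      ext u; simp [Prod.le_def, unitInterval.le_one']
    have f₁ : D.condCdf (m, 1) p.1 = D.condCdf (m, 1) p.2 := by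
      rw [condCdf, condCdf, e₁, e₂, I₁, Measure.real, twistedProd_fst_preimage hn measurableSet_Iic,
        Measure.real, ← prod_univ, Measure.prod_prod, measure_univ, mul_one]
    have f₂ : D.condCdf (1, n) p.1 = D.condCdf (1, n) p.2 := by
      rw [condCdf, condCdf, e₁, e₂, I₂, Measure.real, twistedProd_snd_preimage hm measurableSet_Iic,
        Measure.real, ← univ_prod, Measure.prod_prod, measure_univ, one_mul]
    have f₃ : D.condCdf (m, n) p.1 = 3 / 8 := by
      rw [condCdf, e₁, twistedProd_real_Iic_eq hm hn]
    have f₄ : D.condCdf (m, n) p.2 = 1 / 4 := by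
      rw [condCdf, e₂, prod_real_Iic_eq hm hn]
    simp only [lipschitzDefect, f₁, f₂, f₃, f₄, Pi.zero_apply] at hp
    norm_num at hp
  · rw [hasPositiveDensity_iff, hasPositiveDensity_iff]
    intro hC
    have hv := volume_absolutelyContinuous_averageLaw hb (hC.mono fun t ht => ht.2)
    have hμv : μ ≪ volume := (hμ.trans_le averageLaw_map_fst_le).absolutelyContinuous.trans
      Measure.smul_absolutelyContinuous
    have hνv : ν ≪ volume := (hν.trans_le averageLaw_map_snd_le).absolutelyContinuous.trans
      Measure.smul_absolutelyContinuous
    have hvμ : volume ≪ μ := by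
      have := hv.map measurable_fst
      rwa [Measure.volume_eq_prod, measurePreserving_fst.map_eq, ← hμ] at this
    have hvν : volume ≪ ν := by
      have := hv.map measurable_snd
      rwa [Measure.volume_eq_prod, measurePreserving_snd.map_eq, ← hν] at this
    have hp := hμv.prod hνv
    have hp' := hvμ.prod hvν
    rw [← Measure.volume_eq_prod] at hp hp'
    filter_upwards [hD, hC] with t ht htC
    rw [ht]
    rcases le_or_gt t a with hta | hta
    · rw [hκ₁ t hta]
      exact ⟨twistedProd_absolutelyContinuous.trans hp,
        hp'.trans absolutelyContinuous_twistedProd⟩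
    · rcases le_or_gt t b with htb | htb
      · rw [hκ₂ t hta htb]
        exact ⟨hp, hp'⟩
      · rwa [hκ₃ t htb]

end Copula3

/-! ### Nowhere density in the three kinds of topology -/

namespace Copula3

/-- An interior point of the closure with positive defect would have an open neighbourhood free of
simplified copulas. The map `ι` covers both the full space and the subspace of positive densities.
-/
theorem isNowhereDense_of_isOpen_of_dense {X : Type} [TopologicalSpace X] (ι : X → Copula3)
    (hopen : ∀ u, IsOpen {x | 0 < ∫ p, (ι x).lipschitzDefect u p})
    (hdense : ∀ U : Set X, IsOpen U → U.Nonempty →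
      ∃ x ∈ U, ∃ u, 0 < ∫ p, (ι x).lipschitzDefect u p) :
    IsNowhereDense {x | (ι x).IsSimplified} := by
  by_contra hne
  obtain ⟨x, hx, u, hu⟩ := hdense _ isOpen_interior (nonempty_iff_ne_empty.2 hne)
  obtain ⟨y, hy, hy'⟩ := mem_closure_iff.1 (interior_subset hx) _ (hopen u) hu
  exact hy.ne' (hy'.integral_lipschitzDefect_eq_zero u)

/-- If `D` is close to `C` at the three points that enter the defect, a positive defect of `C`
persists for `D`. -/
theorem integral_lipschitzDefect_pos_of_condDist_lt {C D : Copula3} {u : I × I}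
    (h₀ : D.condDist C u < (∫ p, C.lipschitzDefect u p) / 6)
    (h₁ : D.condDist C (u.1, 1) < (∫ p, C.lipschitzDefect u p) / 6)
    (h₂ : D.condDist C (1, u.2) < (∫ p, C.lipschitzDefect u p) / 6) :
    0 < ∫ p, D.lipschitzDefect u p := by
  have hsymm : ∀ w, C.condDist D w = D.condDist C w := fun w => by simp [condDist, abs_sub_comm]
  -- Three distances, each counted twice, stay below six sixths of the defect of `C`.
  have := C.integral_lipschitzDefect_le_add D u
  rw [hsymm, hsymm, hsymm] at this
  linarith

theorem Dinf_le_of_kernel_eq {C D : Copula3} {b : I}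
    (h : ∀ᵐ t, b < t → D.kernel t = C.kernel t) : D.Dinf C ≤ b := by
  refine ciSup_le fun u => ?_
  calc D.condDist C u ≤ ∫ t, (Iic b).indicator (fun _ => (1 : ℝ)) t := by
        refine integral_mono_ae (D.integrable_abs_condCdf_sub C u)
          ((integrable_const 1).indicator measurableSet_Iic) ?_
        filter_upwards [h] with t ht
        by_cases htb : t ≤ b
        · rw [indicator_of_mem (mem_Iic.2 htb)]
          exact abs_condCdf_sub_le_one D C u t t
        · rw [indicator_of_notMem (by simpa using htb)]
          simp [condCdf, ht (not_le.1 htb)]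
    _ = b := by
        rw [integral_indicator measurableSet_Iic]
        simp [Measure.real, ENNReal.toReal_ofReal b.2.1]

/-- The sandwich D₁ ≤ δ ≤ D_∞ lets openness be checked for the weaker metric and density for the
stronger one; `hι` says that perturbations stay in the space. -/
theorem isNowhereDense_metricTopology {X : Type} (ι : X → Copula3) (δ : X → X → ℝ)
    (h₁ : ∀ x y, (ι x).D₁ (ι y) ≤ δ x y) (h₂ : ∀ x y, δ x y ≤ (ι x).Dinf (ι y))
    (hι : ∀ x D, ((ι x).HasPositiveDensity → D.HasPositiveDensity) → ∃ y, ι y = D) :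
    @IsNowhereDense X (metricTopology δ) {x | (ι x).IsSimplified} := by
  let _ : TopologicalSpace X := metricTopology δ
  refine isNowhereDense_of_isOpen_of_dense ι (fun u x hx => ?_) fun U hU ⟨x, hx⟩ => ?_
  · have hε : 0 < (∫ p, (ι x).lipschitzDefect u p) / 6 := by
      have : 0 < ∫ p, (ι x).lipschitzDefect u p := hx
      positivity
    obtain ⟨r₀, hr₀, H₀⟩ := exists_forall_condDist_lt u hε
    obtain ⟨r₁, hr₁, H₁⟩ := exists_forall_condDist_lt (u.1, 1) hε
    obtain ⟨r₂, hr₂, H₂⟩ := exists_forall_condDist_lt (1, u.2) hε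
    refine ⟨min r₀ (min r₁ r₂), by positivity, fun y hy => ?_⟩
    have hy' := (h₁ y x).trans_lt hy
    simp only [lt_min_iff] at hy'
    exact integral_lipschitzDefect_pos_of_condDist_lt (H₀ _ _ hy'.1) (H₁ _ _ hy'.2.1)
      (H₂ _ _ hy'.2.2)
  · obtain ⟨r, hr, hball⟩ := hU x hx
    have hmin : 0 < min (r / 2) 1 := by positivity
    obtain ⟨D, hD, hu, hpos⟩ := (ι x).exists_perturbation
      (b := ⟨min (r / 2) 1, hmin.le, min_le_right _ _⟩) hmin
    obtain ⟨y, rfl⟩ := hι x D hpos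
    refine ⟨y, hball y ?_, hu⟩
    calc δ y x ≤ min (r / 2) 1 := (h₂ y x).trans (Dinf_le_of_kernel_eq hD)
      _ ≤ r / 2 := min_le_left _ _
      _ < r := half_lt_self hr

theorem isNowhereDense_wccTopology : @IsNowhereDense Copula3 wccTopology {C | C.IsSimplified} := by
  let _ : TopologicalSpace Copula3 := wccTopology
  refine isNowhereDense_of_isOpen_of_dense id (fun u C hC Cs h => ?_) fun U hU ⟨C, hC⟩ => ?_
  · have hε : 0 < (∫ p, C.lipschitzDefect u p) / 6 := by
      have : 0 < ∫ p, C.lipschitzDefect u p := hC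
      positivity
    filter_upwards [(tendsto_condDist_of_WCC h u).eventually_lt_const hε,
      (tendsto_condDist_of_WCC h (u.1, 1)).eventually_lt_const hε,
      (tendsto_condDist_of_WCC h (1, u.2)).eventually_lt_const hε] with n h₀ h₁ h₂
    exact integral_lipschitzDefect_pos_of_condDist_lt h₀ h₁ h₂
  · let b : ℕ → I := fun n =>
      ⟨1 / (n + 1), by positivity, div_le_one_of_le₀ (by linarith [n.cast_nonneg (α := ℝ)])
        (by positivity)⟩
    have hb : ∀ n, 0 < b n := fun n => by
      change (0 : ℝ) < 1 / (n + 1)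
      positivity
    choose Cs hCs hu _ using fun n => C.exists_perturbation (hb n)
    -- Each t > 0 eventually exceeds 1/(n+1); from then on the conditional law at t is exactly that
    -- of `C`, outside a countable union of null sets.
    have hconv : WCC Cs C := by
      have h0 : ∀ᵐ t : I, t ≠ 0 := by simp [ae_iff]
      filter_upwards [ae_all_iff.2 hCs, h0] with t ht ht0
      refine tendsto_const_nhds.congr' ?_
      have htpos : (0 : ℝ) < t := unitInterval.pos_iff_ne_zero.2 ht0
      filter_upwards [(tendsto_one_div_add_atTop_nhds_zero_nat (𝕜 := ℝ)).eventually_lt_const htpos]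
        with n hn
      exact Subtype.ext (ht n hn).symm
    obtain ⟨n, hn⟩ := (hU C hC Cs hconv).exists
    exact ⟨Cs n, hn, hu n⟩

end Copula3

theorem theorem3p5 :
    (@IsNowhereDense Copula3 (metricTopology Copula3.D₁) {C | C.IsSimplified} ∧
      @IsNowhereDense Copula3 (metricTopology Copula3.Dinf) {C | C.IsSimplified}) ∧
    @IsNowhereDense Copula3 Copula3.wccTopology {C | C.IsSimplified} ∧
    (@IsNowhereDense PosDensityCopula3
        (metricTopology fun C₁ C₂ : PosDensityCopula3 => Copula3.D₁ C₁.1 C₂.1)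
        {C | C.1.IsSimplified} ∧
      @IsNowhereDense PosDensityCopula3
        (metricTopology fun C₁ C₂ : PosDensityCopula3 => Copula3.Dinf C₁.1 C₂.1)
        {C | C.1.IsSimplified}) := by
  refine ⟨⟨?_, ?_⟩, Copula3.isNowhereDense_wccTopology, ?_, ?_⟩
  · exact Copula3.isNowhereDense_metricTopology id _ (fun _ _ => le_rfl)
      (fun C D => C.D₁_le_Dinf D) fun _ D _ => ⟨D, rfl⟩
  · exact Copula3.isNowhereDense_metricTopology id _ (fun C D => C.D₁_le_Dinf D)
      (fun _ _ => le_rfl) fun _ D _ => ⟨D, rfl⟩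
  · exact Copula3.isNowhereDense_metricTopology Subtype.val _ (fun _ _ => le_rfl)
      (fun C D => C.1.D₁_le_Dinf D.1) fun C D h => ⟨⟨D, h C.2⟩, rfl⟩
  · exact Copula3.isNowhereDense_metricTopology Subtype.val _ (fun C D => C.1.D₁_le_Dinf D.1)
      (fun _ _ => le_rfl) fun C D h => ⟨⟨D, h C.2⟩, rfl⟩
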